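/- **Conventions.** An o-minimal structure on $\mathbb{R}$ is a first-order structure with universe $\mathbb{R}$ in which the order $<$ is definable and in which every subset of $\mathbb{R}$ definable with parameters is a finite union of points and intervals; "definable" means definable with parameters. The dimension of a nonempty definable set $X\subset\mathbb{R}^n$ is the largest $k$ such that the image of $X$ under the projection to some $k$ of the coordinates has nonempty interior in $\mathbb{R}^k$. A set $X\subset\mathbb{R}^n$ is *$C^1$ smooth* if there is a $k$ such that $X$ is a $k$-dimensional $C^1$ submanifold of $\mathbb{R}^n$, i.e. every $p\in X$ has an open neighbourhood in $\mathbb{R}^n$ that some $C^1$ diffeomorphism onto an open subset of $\mathbb{R}^n$ maps so that $X$ corresponds to the part of a $k$-dimensional linear subspace in that open subset. For $p\in X$, the cone $C_5(X,p)$ is the set of all $v\in\mathbb{R}^n$ for which there are sequences $(x_i),(y_i)$ in $X$ tending to $p$ and positive reals $t_i$ with $\lim_{i\to\infty}\frac{1}{t_i}(x_i-y_i)=v$. **Theorem.** Let $X\subset\mathbb{R}^n$ be a locally closed $d$-dimensional set definable in an o-minimal structure on $\mathbb{R}$. Then $X$ is $C^1$ smooth if and only if for every $p\in X$ the following holds: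 $C_5(X,p)$ is a $d$-dimensional linear subspace of $\mathbb{R}^n$, and the restriction to $X$ of the orthogonal projection $\pi\colon\mathbb{R}^n\to C_5(X,p)$ is an open mapping near $p$, that is, there is an open neighbourhood $U$ of $p$ such that $\pi|_{X\cap U}\colon X\cap U\to C_5(X,p)$ is an open mapping. -/

import Mathlib

open Filter Topology

universe u v

/-- The structure `L` on `ℝ` is o-minimal: the order is definable, and every subset of `ℝ` definable
with parameters is a finite union of intervals (order-connected sets; points, rays, `ℝ` and `∅`
included). Expansions of the real field are a special case. -/
structure IsOMinimal (L : FirstOrder.Language.{u, v}) [L.Structure ℝ] : Prop where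
  lt_definable : (Set.univ : Set ℝ).Definable₂ L {q : ℝ × ℝ | q.1 < q.2}
  finite_union : ∀ s : Set ℝ, (Set.univ : Set ℝ).Definable₁ L s →
    ∃ F : Set (Set ℝ), F.Finite ∧ (∀ I ∈ F, I.OrdConnected) ∧ s = ⋃₀ F

/-- A subset of Euclidean space is definable (with parameters) in the structure `L` on `ℝ`. -/
def IsDefinableIn (L : FirstOrder.Language.{u, v}) [L.Structure ℝ] {n : ℕ}
    (X : Set (EuclideanSpace ℝ (Fin n))) : Prop :=
  (Set.univ : Set ℝ).Definable L {v : Fin n → ℝ | WithLp.toLp 2 v ∈ X}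

/-- The definable set `X` has o-minimal dimension `d`: `d` is the largest `k` such that the image
of `X` under some projection to `k` of the coordinates has nonempty interior in `ℝᵏ`.
(The empty set has no dimension `d : ℕ`.) -/
def HasDefinableDim {n : ℕ} (X : Set (EuclideanSpace ℝ (Fin n))) (d : ℕ) : Prop :=
  IsGreatest {k : ℕ | ∃ e : Fin k ↪ Fin n,
    (interior ((fun (x : EuclideanSpace ℝ (Fin n)) (i : Fin k) => x (e i)) '' X)).Nonempty} d

/-- The fifth tangent cone `C₅(X, p)`: limits of `(xᵢ - yᵢ) / tᵢ` with `xᵢ, yᵢ ∈ X` tending to `p`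
and `tᵢ > 0`. -/
def tangentCone5 {n : ℕ} (X : Set (EuclideanSpace ℝ (Fin n))) (p : EuclideanSpace ℝ (Fin n)) :
    Set (EuclideanSpace ℝ (Fin n)) :=
  {v | ∃ (x y : ℕ → EuclideanSpace ℝ (Fin n)) (t : ℕ → ℝ),
    (∀ i, x i ∈ X) ∧ (∀ i, y i ∈ X) ∧ (∀ i, 0 < t i) ∧
    Tendsto x atTop (𝓝 p) ∧ Tendsto y atTop (𝓝 p) ∧
    Tendsto (fun i => (1 / t i) • (x i - y i)) atTop (𝓝 v)}

/-- Around `p`, the set `X` is a `k`-dimensional `C¹` submanifold: a `C¹` diffeomorphism `Φ` between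
open sets, the source containing `p`, carries `X` to a `k`-dimensional linear subspace. -/
def IsC1SubmanifoldAt {n : ℕ} (k : ℕ) (X : Set (EuclideanSpace ℝ (Fin n)))
    (p : EuclideanSpace ℝ (Fin n)) : Prop :=
  ∃ (W : Submodule ℝ (EuclideanSpace ℝ (Fin n)))
    (Φ : OpenPartialHomeomorph (EuclideanSpace ℝ (Fin n)) (EuclideanSpace ℝ (Fin n))),
    Module.finrank ℝ W = k ∧ p ∈ Φ.source ∧
    ContDiffOn ℝ 1 Φ Φ.source ∧ ContDiffOn ℝ 1 Φ.symm Φ.target ∧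
    Φ '' (X ∩ Φ.source) = (W : Set (EuclideanSpace ℝ (Fin n))) ∩ Φ.target

/-- `X` is `C¹` smooth: a `C¹` submanifold, of one dimension `k`, around each of its points. -/
def IsC1Smooth {n : ℕ} (X : Set (EuclideanSpace ℝ (Fin n))) : Prop :=
  ∃ k : ℕ, ∀ p ∈ X, IsC1SubmanifoldAt k X p

/-- The restriction to `X` of the orthogonal projection onto `P` is an open mapping near `p`: for
some open neighbourhood `U` of `p`, the map `X ∩ U → P` is open. -/
def IsOpenProjNear {n : ℕ} (X : Set (EuclideanSpace ℝ (Fin n)))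
    (P : Submodule ℝ (EuclideanSpace ℝ (Fin n))) (p : EuclideanSpace ℝ (Fin n)) : Prop :=
  ∃ U : Set (EuclideanSpace ℝ (Fin n)), IsOpen U ∧ p ∈ U ∧
    IsOpenMap (fun x : ↥(X ∩ U) => P.orthogonalProjectionOnto (x : EuclideanSpace ℝ (Fin n)))

/-! If `C₅(X, p) = P`, compactness of the unit sphere makes all secants of `X` near `p` almost
parallel to `P`. So the projection `π` to `P` is injective on `X` near `p`, with Lipschitz inverse
`h`. Openness of `π` on `X` makes the domain of `h` open: `X` is locally a Lipschitz graph. The same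
secant estimate at each nearby point `q`, where `C₅(X, q)` has the same dimension and projects
isomorphically to `P`, shows that `h` is strictly differentiable everywhere, hence `C¹`. A shear
flattens the graph (`isC1SubmanifoldAt_of_tangentCone5`).

Conversely, charts are strictly differentiable, so `C₅` is the tangent space, and the inverse
function theorem makes the projection open (`IsC1SubmanifoldAt.exists_tangentSpace`). The manifold
dimension is `d` by comparing coordinate projections with Hausdorff dimension. -/

/-- A function that is strictly differentiable at every point of an open set is `C¹` there. -/
theorem contDiffOn_one_of_hasStrictFDerivAt {E F : Type*} [NormedAddCommGroup E] [NormedSpace ℝ E]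
    [NormedAddCommGroup F] [NormedSpace ℝ F] {f : E → F} {s : Set E} (hs : IsOpen s)
    (hf : ∀ x ∈ s, ∃ f' : E →L[ℝ] F, HasStrictFDerivAt f f' x) : ContDiffOn ℝ 1 f s := by
  choose! f' hf' using hf
  intro x hx
  refine (contDiffAt_one_iff.2 ⟨f', s, hs.mem_nhds hx, fun y hy => ?_,
    fun y hy => (hf' y hy).hasFDerivAt⟩).contDiffWithinAt
  refine ContinuousAt.continuousWithinAt (Metric.continuousAt_iff'.2 fun ε hε => ?_)
  have hε2 : 0 < ε / 2 := half_pos hε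
  obtain ⟨u, hu, hlip⟩ := (hf' y hy).approximates_deriv_on_nhds (c := (ε / 2).toNNReal)
    (Or.inr (by simpa using hε2))
  filter_upwards [eventually_mem_nhds_iff.2 hu, hs.mem_nhds hy] with z hz hzs
  rw [dist_eq_norm]
  have h := ((hf' z hzs).hasFDerivAt.sub (f' y).hasFDerivAt).le_of_lipschitzOn hz
    hlip.lipschitzOnWith
  rw [Real.coe_toNNReal _ hε2.le] at h
  linarith

/-! ### From cones to a `C¹` graph -/

variable {n : ℕ}

/-- A linear map vanishing on `C₅(X, p)` is infinitesimally small on secants of `X` near `p`. -/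
theorem eventually_norm_map_sub_le_of_tangentCone5 {F : Type*} [NormedAddCommGroup F]
    [NormedSpace ℝ F] {X : Set (EuclideanSpace ℝ (Fin n))} {p : EuclideanSpace ℝ (Fin n)}
    (T : EuclideanSpace ℝ (Fin n) →L[ℝ] F) (hT : ∀ w ∈ tangentCone5 X p, T w = 0)
    {ε : ℝ} (hε : 0 < ε) :
    ∃ r > 0, ∀ x ∈ X ∩ Metric.ball p r, ∀ y ∈ X ∩ Metric.ball p r,
      ‖T (x - y)‖ ≤ ε * ‖x - y‖ := by
  by_contra! hcon
  have hpos : ∀ i : ℕ, (0 : ℝ) < 1 / ((i : ℝ) + 1) := fun i => by positivity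
  choose x hx y hy hxy using fun i : ℕ => hcon _ (hpos i)
  have hlim : ∀ z : ℕ → EuclideanSpace ℝ (Fin n),
      (∀ i : ℕ, z i ∈ X ∩ Metric.ball p (1 / ((i : ℝ) + 1))) → Tendsto z atTop (𝓝 p) := by
    intro z hz
    rw [tendsto_iff_dist_tendsto_zero]
    exact squeeze_zero (fun _ => dist_nonneg) (fun i => (hz i).2.le)
      tendsto_one_div_add_atTop_nhds_zero_nat
  have hne : ∀ i, 0 < ‖x i - y i‖ := by
    intro i
    refine norm_pos_iff.2 fun h => ?_
    have := hxy i
    simp [h] at this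
  have hunit : ∀ i, (1 / ‖x i - y i‖) • (x i - y i) ∈
      Metric.sphere (0 : EuclideanSpace ℝ (Fin n)) 1 := by
    intro i
    have := (hne i).ne'
    simp [norm_smul, this]
  -- Unit secants violating the bound at scales `1 / (i + 1)` subconverge to some `w` in the cone
  -- with `‖T w‖ ≥ ε`.
  obtain ⟨w, -, φ, hφ, hw⟩ := (isCompact_sphere _ _).tendsto_subseq hunit
  have hmem : w ∈ tangentCone5 X p :=
    ⟨x ∘ φ, y ∘ φ, fun i => ‖x (φ i) - y (φ i)‖, fun i => (hx _).1, fun i => (hy _).1,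
      fun i => hne _, (hlim x hx).comp hφ.tendsto_atTop, (hlim y hy).comp hφ.tendsto_atTop, hw⟩
  have h0 : Tendsto (fun i => ‖T ((1 / ‖x (φ i) - y (φ i)‖) • (x (φ i) - y (φ i)))‖) atTop
      (𝓝 ‖T w‖) := ((T.continuous.tendsto w).comp hw).norm
  rw [hT w hmem, norm_zero] at h0
  refine absurd (ge_of_tendsto' h0 fun i => ?_) (not_le.2 hε)
  rw [map_smul, norm_smul, norm_div, norm_one, norm_norm, one_div_mul_eq_div, le_div_iff₀ (hne _)]
  exact (hxy _).le

/-- A linear lower bound on the secants of `X` near `q` passes to `C₅(X, q)`. -/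
theorem norm_le_of_mem_tangentCone5 {F : Type*} [NormedAddCommGroup F] [NormedSpace ℝ F]
    {X U : Set (EuclideanSpace ℝ (Fin n))} {q w : EuclideanSpace ℝ (Fin n)}
    (T : EuclideanSpace ℝ (Fin n) →L[ℝ] F) {K : ℝ} (hU : U ∈ 𝓝 q)
    (hK : ∀ x ∈ X ∩ U, ∀ y ∈ X ∩ U, ‖x - y‖ ≤ K * ‖T (x - y)‖) (hw : w ∈ tangentCone5 X q) :
    ‖w‖ ≤ K * ‖T w‖ := by
  obtain ⟨x, y, t, hx, hy, ht, hxq, hyq, hlim⟩ := hw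
  refine le_of_tendsto_of_tendsto hlim.norm
    (((T.continuous.tendsto w).comp hlim).norm.const_mul K) ?_
  filter_upwards [hxq hU, hyq hU] with i hi hi'
  have h := hK _ ⟨hx i, hi⟩ _ ⟨hy i, hi'⟩
  simp only [Function.comp, map_smul, norm_smul]
  calc _ ≤ ‖1 / t i‖ * (K * ‖T (x i - y i)‖) := by gcongr
    _ = _ := by ring

/-- A Lipschitz section of the projection to `P` with values in `X` is strictly differentiable at a
point where `C₅(X, ·)` is a linear subspace of the dimension of `P`. -/
theorem exists_hasStrictFDerivAt_of_section {X U : Set (EuclideanSpace ℝ (Fin n))}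
    {P Q : Submodule ℝ (EuclideanSpace ℝ (Fin n))} {V : Set P} {h : P → EuclideanSpace ℝ (Fin n)}
    {v₀ : P} {K : ℝ} (hV : IsOpen V) (hU : IsOpen U) (hh : ∀ v ∈ V, h v ∈ X ∩ U)
    (hsec : ∀ v ∈ V, P.orthogonalProjectionOnto (h v) = v)
    (hK : ∀ x ∈ X ∩ U, ∀ y ∈ X ∩ U, ‖x - y‖ ≤ K * ‖P.orthogonalProjectionOnto (x - y)‖)
    (hv₀ : v₀ ∈ V) (hQ : tangentCone5 X (h v₀) = Q)
    (hdim : Module.finrank ℝ Q = Module.finrank ℝ P) :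
    ∃ h' : P →L[ℝ] EuclideanSpace ℝ (Fin n), HasStrictFDerivAt h h' v₀ := by
  have hlip : ∀ u ∈ V, ∀ v ∈ V, ‖h u - h v‖ ≤ K * ‖u - v‖ := by
    intro u hu v hv
    simpa only [map_sub, hsec u hu, hsec v hv] using hK _ (hh u hu) _ (hh v hv)
  have hinj : Function.Injective
      ((P.orthogonalProjectionOnto : EuclideanSpace ℝ (Fin n) →ₗ[ℝ] P) ∘ₗ Q.subtype) := by
    rw [← LinearMap.ker_eq_bot, LinearMap.ker_eq_bot']
    intro w hw
    have := norm_le_of_mem_tangentCone5 P.orthogonalProjectionOnto (hU.mem_nhds (hh v₀ hv₀).2) hK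
      (w := (w : EuclideanSpace ℝ (Fin n))) (hQ ▸ w.2)
    have hw' : P.orthogonalProjectionOnto (w : EuclideanSpace ℝ (Fin n)) = 0 := hw
    rw [hw', norm_zero, mul_zero] at this
    exact Subtype.ext (norm_le_zero_iff.1 this)
  -- The derivative of `h` must be the inverse of the projection `Q → P`.
  let e := LinearMap.linearEquivOfInjective _ hinj hdim
  let A : P →L[ℝ] EuclideanSpace ℝ (Fin n) :=
    (Q.subtype ∘ₗ (e.symm : P →ₗ[ℝ] Q)).toContinuousLinearMap
  have hA : ∀ w ∈ Q, A (P.orthogonalProjectionOnto w) = w := by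
    intro w hw
    have : e.symm (P.orthogonalProjectionOnto w) = ⟨w, hw⟩ := by
      rw [LinearEquiv.symm_apply_eq]; rfl
    change ((e.symm (P.orthogonalProjectionOnto w) : Q) : EuclideanSpace ℝ (Fin n)) = w
    rw [this]
  refine ⟨A, .of_isLittleO (Asymptotics.isLittleO_iff.2 fun c hc => ?_)⟩
  -- `id - A ∘ π` kills the cone, and on the secant `h u - h v` it is exactly the linearization
  -- error. The factor `|K| + 1` converts `‖h u - h v‖` to `‖u - v‖` and stays positive.
  obtain ⟨r, hr, hT⟩ := eventually_norm_map_sub_le_of_tangentCone5 (X := X) (p := h v₀)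
    (ContinuousLinearMap.id ℝ _ - A.comp P.orthogonalProjectionOnto)
    (fun w hw => by
      have hw' : w ∈ Q := by rw [hQ] at hw; exact hw
      simp [hA w hw']) (ε := c / (|K| + 1)) (by positivity)
  have hcont : ContinuousAt h v₀ := by
    rw [ContinuousAt, tendsto_iff_norm_sub_tendsto_zero]
    refine squeeze_zero' (Eventually.of_forall fun _ => norm_nonneg _)
      (mem_of_superset (hV.mem_nhds hv₀) fun v hv => hlip v hv v₀ hv₀)
      (g := fun v => K * ‖v - v₀‖) ?_
    have : ContinuousAt (fun v : P => K * ‖v - v₀‖) v₀ := by fun_prop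
    simpa [ContinuousAt] using this
  have hev : ∀ᶠ v in 𝓝 v₀, v ∈ V ∧ h v ∈ Metric.ball (h v₀) r :=
    inter_mem (hV.mem_nhds hv₀) (hcont (Metric.ball_mem_nhds _ hr))
  rw [nhds_prod_eq]
  filter_upwards [hev.prod_mk hev] with z hz
  obtain ⟨⟨hu, hu'⟩, hv, hv'⟩ := hz
  have h1 := hT _ ⟨(hh _ hu).1, hu'⟩ _ ⟨(hh _ hv).1, hv'⟩
  simp only [sub_apply, ContinuousLinearMap.comp_apply,
    ContinuousLinearMap.id_apply, map_sub P.orthogonalProjectionOnto, hsec _ hu, hsec _ hv] at h1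
  calc _ ≤ c / (|K| + 1) * ‖h z.1 - h z.2‖ := h1
    _ ≤ c / (|K| + 1) * ((|K| + 1) * ‖z.1 - z.2‖) := by
      gcongr
      refine (hlip _ hu _ hv).trans ?_
      gcongr
      linarith [le_abs_self K]
    _ = c * ‖z.1 - z.2‖ := by field_simp

/-- Shear of Euclidean space along a function on an open subset of a subspace `P` with values
orthogonal to `P`. -/
noncomputable def orthogonalShear (P : Submodule ℝ (EuclideanSpace ℝ (Fin n))) {V : Set P}
    (hV : IsOpen V) (g : P → EuclideanSpace ℝ (Fin n)) (hg : ContinuousOn g V)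
    (hgP : ∀ v ∈ V, P.orthogonalProjectionOnto (g v) = 0) :
    OpenPartialHomeomorph (EuclideanSpace ℝ (Fin n)) (EuclideanSpace ℝ (Fin n)) where
  -- As `g` is orthogonal to `P`, the shear preserves `π`, so adding `g` back inverts it.
  toFun x := x - g (P.orthogonalProjectionOnto x)
  invFun x := x + g (P.orthogonalProjectionOnto x)
  source := P.orthogonalProjectionOnto ⁻¹' V
  target := P.orthogonalProjectionOnto ⁻¹' V
  map_source' x hx := by simpa [map_sub, hgP _ hx] using hx
  map_target' x hx := by simpa [map_add, hgP _ hx] using hx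
  left_inv' x hx := by simp [map_sub, hgP _ hx]
  right_inv' x hx := by simp [map_add, hgP _ hx]
  open_source := hV.preimage P.orthogonalProjectionOnto.continuous
  open_target := hV.preimage P.orthogonalProjectionOnto.continuous
  continuousOn_toFun := continuousOn_id.sub
    (hg.comp P.orthogonalProjectionOnto.continuous.continuousOn fun _ hx => hx)
  continuousOn_invFun := continuousOn_id.add
    (hg.comp P.orthogonalProjectionOnto.continuous.continuousOn fun _ hx => hx)

/-- If the cones `C₅(X, q)` are subspaces of constant dimension and the projection to `C₅(X, p)` is
open near `p`, then `X` is a `C¹` submanifold around `p`. -/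
theorem isC1SubmanifoldAt_of_tangentCone5 {X : Set (EuclideanSpace ℝ (Fin n))} {d : ℕ}
    (hX : ∀ q ∈ X, ∃ Q : Submodule ℝ (EuclideanSpace ℝ (Fin n)),
      tangentCone5 X q = Q ∧ Module.finrank ℝ Q = d)
    {p : EuclideanSpace ℝ (Fin n)} (hp : p ∈ X) {P : Submodule ℝ (EuclideanSpace ℝ (Fin n))}
    (hP : tangentCone5 X p = P) (hPd : Module.finrank ℝ P = d) (hopen : IsOpenProjNear X P p) :
    IsC1SubmanifoldAt d X p := by
  obtain ⟨U₀, hU₀, hpU₀, hmap⟩ := hopen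
  set π := P.orthogonalProjectionOnto with hπ
  have hππ : ∀ v : P, π (v : EuclideanSpace ℝ (Fin n)) = v :=
    P.orthogonalProjectionOnto_mem_subspace_eq_self
  -- With `ε = 1 / 2` the normal part of a secant is absorbed, which gives the constant `2` in `hK`.
  obtain ⟨r, hr, hT⟩ := eventually_norm_map_sub_le_of_tangentCone5 (X := X) (p := p)
    (ContinuousLinearMap.id ℝ _ - P.subtypeL.comp π)
    (fun w hw => by
      have hw' : w ∈ P := by rw [hP] at hw; exact hw
      have := congrArg Subtype.val (hππ ⟨w, hw'⟩)
      simp only [sub_apply, ContinuousLinearMap.comp_apply,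
        ContinuousLinearMap.id_apply, Submodule.subtypeL_apply]
      rw [this, sub_self]) (ε := 1 / 2) (by norm_num)
  set U := U₀ ∩ Metric.ball p r with hUdef
  have hU : IsOpen U := hU₀.inter Metric.isOpen_ball
  have hpU : p ∈ U := ⟨hpU₀, Metric.mem_ball_self hr⟩
  have hK : ∀ x ∈ X ∩ U, ∀ y ∈ X ∩ U, ‖x - y‖ ≤ 2 * ‖π (x - y)‖ := by
    intro x hx y hy
    have h1 := hT x ⟨hx.1, hx.2.2⟩ y ⟨hy.1, hy.2.2⟩
    have h2 : ‖x - y‖ ≤ ‖((π (x - y) : P) : EuclideanSpace ℝ (Fin n))‖ +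
        ‖(ContinuousLinearMap.id ℝ (EuclideanSpace ℝ (Fin n)) - P.subtypeL.comp π) (x - y)‖ := by
      refine le_trans (le_of_eq ?_) (norm_add_le _ _)
      simp
    rw [← Submodule.coe_norm] at h2
    linarith
  have hinj : ∀ x ∈ X ∩ U, ∀ y ∈ X ∩ U, π x = π y → x = y := by
    intro x hx y hy hxy
    have := hK x hx y hy
    rw [map_sub, hxy, sub_self, norm_zero, mul_zero] at this
    exact sub_eq_zero.1 (norm_le_zero_iff.1 this)
  set V : Set P := π '' (X ∩ U) with hVdef
  have hV : IsOpen V := by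
    convert hmap ((↑) ⁻¹' U) (hU.preimage continuous_subtype_val) using 1
    ext v
    simp only [hVdef, hUdef, Set.mem_image, Set.mem_preimage, Subtype.exists]
    constructor
    · rintro ⟨x, hx, rfl⟩
      exact ⟨x, ⟨hx.1, hx.2.1⟩, hx.2, rfl⟩
    · rintro ⟨x, hx, hx', rfl⟩
      exact ⟨x, ⟨hx.1, hx'⟩, rfl⟩
  obtain ⟨h, hh⟩ : ∃ h : P → EuclideanSpace ℝ (Fin n), ∀ v ∈ V, h v ∈ X ∩ U ∧ π (h v) = v := by
    have : ∀ v : P, ∃ x, v ∈ V → x ∈ X ∩ U ∧ π x = v := by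
      intro v
      by_cases hv : v ∈ V
      · obtain ⟨x, hx⟩ := hv
        exact ⟨x, fun _ => hx⟩
      · exact ⟨0, fun h => absurd h hv⟩
    choose h hh using this
    exact ⟨h, hh⟩
  have hC1 : ContDiffOn ℝ 1 h V := by
    refine contDiffOn_one_of_hasStrictFDerivAt hV fun v hv => ?_
    obtain ⟨Q, hQ, hQd⟩ := hX (h v) (hh v hv).1.1
    exact exists_hasStrictFDerivAt_of_section hV hU (fun v hv => (hh v hv).1)
      (fun v hv => (hh v hv).2) hK hv hQ (hQd.trans hPd.symm)
  set g : P → EuclideanSpace ℝ (Fin n) := fun v => h v - v with hg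
  have hgC1 : ContDiffOn ℝ 1 g V := hC1.sub P.subtypeL.contDiff.contDiffOn
  have hgP : ∀ v ∈ V, π (g v) = 0 := by
    intro v hv
    simp only [hg, map_sub, (hh v hv).2, hππ, sub_self]
  have hgπ : ContDiffOn ℝ 1 (fun x => g (π x)) (π ⁻¹' V) :=
    hgC1.comp π.contDiff.contDiffOn fun _ hx => hx
  refine ⟨P, (orthogonalShear P hV g hgC1.continuousOn hgP).restrOpen U hU, hPd,
    ⟨⟨p, ⟨hp, hpU⟩, rfl⟩, hpU⟩, ?_, ?_, ?_⟩
  · exact (contDiffOn_id.sub hgπ).mono fun x hx => hx.1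
  · exact (contDiffOn_id.add hgπ).mono fun x hx => hx.1
  · have hgx : ∀ x ∈ X ∩ U, x - g (π x) = π x := by
      intro x hx
      have hv : π x ∈ V := ⟨x, hx, rfl⟩
      change x - (h (π x) - π x) = π x
      rw [hinj _ (hh _ hv).1 x hx (hh _ hv).2]
      exact sub_sub_cancel _ _
    ext y
    constructor
    · rintro ⟨x, ⟨hxX, hxs⟩, rfl⟩
      refine ⟨?_, OpenPartialHomeomorph.map_source _ hxs⟩
      change x - g (π x) ∈ P
      rw [hgx x ⟨hxX, hxs.2⟩]
      exact (π x).2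
    · rintro ⟨hyP, hyt⟩
      have hyV : π y ∈ V := hyt.1
      have hyU : y + g (π y) ∈ U := hyt.2
      have hπy : ((π y : P) : EuclideanSpace ℝ (Fin n)) = y := congrArg Subtype.val (hππ ⟨y, hyP⟩)
      have hxy : y + g (π y) = h (π y) := by
        simp only [hg, hπy]; abel
      refine ⟨y + g (π y), ⟨hxy ▸ (hh _ hyV).1.1, OpenPartialHomeomorph.map_target _ hyt⟩, ?_⟩
      exact OpenPartialHomeomorph.right_inv _ hyt

/-! ### The tangent space of a `C¹` submanifold -/

/-- A `C¹` diffeomorphism between open sets is strictly differentiable, with invertible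
derivative. -/
theorem OpenPartialHomeomorph.exists_hasStrictFDerivAt_equiv {E : Type*} [NormedAddCommGroup E]
    [NormedSpace ℝ E] (Φ : OpenPartialHomeomorph E E) {p : E} (hp : p ∈ Φ.source)
    (hΦ : ContDiffOn ℝ 1 Φ Φ.source) (hΦ' : ContDiffOn ℝ 1 Φ.symm Φ.target) :
    ∃ D : E ≃L[ℝ] E, HasStrictFDerivAt Φ (D : E →L[ℝ] E) p ∧
      HasStrictFDerivAt Φ.symm (D.symm : E →L[ℝ] E) (Φ p) := by
  have hs := Φ.open_source.mem_nhds hp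
  have ht := Φ.open_target.mem_nhds (Φ.map_source hp)
  have h1 := (hΦ.contDiffAt hs).hasStrictFDerivAt one_ne_zero
  have h2 := (hΦ'.contDiffAt ht).hasStrictFDerivAt one_ne_zero
  have h12 : (fderiv ℝ Φ.symm (Φ p)).comp (fderiv ℝ Φ p) = ContinuousLinearMap.id ℝ E := by
    refine (h2.hasFDerivAt.comp p h1.hasFDerivAt).unique ((hasFDerivAt_id p).congr_of_eventuallyEq ?_)
    filter_upwards [hs] with x hx using Φ.left_inv hx
  have h21 : (fderiv ℝ Φ p).comp (fderiv ℝ Φ.symm (Φ p)) = ContinuousLinearMap.id ℝ E := by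
    have h1' := h1.hasFDerivAt
    rw [← Φ.left_inv hp] at h1'
    have := h1'.comp (Φ p) h2.hasFDerivAt
    rw [Φ.left_inv hp] at this
    refine this.unique ((hasFDerivAt_id _).congr_of_eventuallyEq ?_)
    filter_upwards [ht] with x hx using Φ.right_inv hx
  exact ⟨ContinuousLinearEquiv.equivOfInverse _ _ (DFunLike.congr_fun h12)
    (DFunLike.congr_fun h21), h1, h2⟩

/-- A `C¹` submanifold has a tangent space: it equals `C₅`, and every linear map that is injective
on it, with target of the same dimension, restricts to an open mapping near the point. -/
theorem IsC1SubmanifoldAt.exists_tangentSpace {X : Set (EuclideanSpace ℝ (Fin n))}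
    {p : EuclideanSpace ℝ (Fin n)} {k : ℕ} (h : IsC1SubmanifoldAt k X p) (hp : p ∈ X) :
    ∃ P : Submodule ℝ (EuclideanSpace ℝ (Fin n)), tangentCone5 X p = P ∧
      Module.finrank ℝ P = k ∧
      ∀ (F : Type) [NormedAddCommGroup F] [NormedSpace ℝ F] [FiniteDimensional ℝ F]
        (T : EuclideanSpace ℝ (Fin n) →L[ℝ] F), (∀ v ∈ P, T v = 0 → v = 0) →
        Module.finrank ℝ F = k → ∃ U : Set (EuclideanSpace ℝ (Fin n)), IsOpen U ∧ p ∈ U ∧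
          IsOpenMap (fun x : ↥(X ∩ U) => T x) := by
  obtain ⟨W, Φ, hW, hps, hΦ, hΦ', himg⟩ := h
  obtain ⟨D, hD, hD'⟩ := Φ.exists_hasStrictFDerivAt_equiv hps hΦ hΦ'
  have hXW : ∀ x ∈ X, x ∈ Φ.source → Φ x ∈ W := fun x hx hxs =>
    (himg.subset (Set.mem_image_of_mem Φ ⟨hx, hxs⟩)).1
  have hWX : ∀ w ∈ W, w ∈ Φ.target → Φ.symm w ∈ X := by
    intro w hw hwt
    obtain ⟨x, hx, rfl⟩ := himg.superset ⟨hw, hwt⟩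
    rw [Φ.left_inv hx.2]
    exact hx.1
  have hpt := Φ.map_source hps
  have hpW := hXW p hp hps
  refine ⟨W.map (D.symm : EuclideanSpace ℝ (Fin n) →ₗ[ℝ] EuclideanSpace ℝ (Fin n)), ?_, ?_, ?_⟩
  · ext v
    constructor
    · rintro ⟨x, y, t, hx, hy, ht, hxp, hyp, hlim⟩
      refine ⟨D v, ?_, D.symm_apply_apply v⟩
      have hs := Φ.open_source.mem_nhds hps
      refine W.closed_of_finiteDimensional.mem_of_tendsto
        (f := fun i => (1 / t i) • (Φ (x i) - Φ (y i))) (b := atTop) ?_ ?_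
      -- Both ends of the secant move, so strict differentiability is what is needed here.
      · have hlit := (hD.isLittleO.comp_tendsto (hxp.prodMk_nhds hyp))
        have hO : (fun i => (1 / t i) • (x i - y i)) =O[atTop] fun _ => (1 : ℝ) :=
          hlim.isBigO_one ℝ
        have hsm : (fun i => (1 / t i) • (Φ (x i) - Φ (y i) - D (x i - y i))) =o[atTop]
            fun _ => (1 : ℝ) :=
          ((Asymptotics.isBigO_refl (fun i => 1 / t i) atTop).smul_isLittleO hlit).trans_isBigO hO
        have h0 := (Asymptotics.isLittleO_one_iff ℝ).1 hsm
        have := h0.add ((D.continuous.tendsto v).comp hlim)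
        rw [zero_add] at this
        refine this.congr fun i => ?_
        simp [smul_sub]
      · filter_upwards [hxp hs, hyp hs] with i hi hi'
        exact W.smul_mem _ (W.sub_mem (hXW _ (hx i) hi) (hXW _ (hy i) hi'))
    · rintro ⟨w, hw, rfl⟩
      set t : ℕ → ℝ := fun i => 1 / ((i : ℝ) + 1) with ht
      have ht0 : ∀ i, 0 < t i := fun i => by positivity
      have htlim : Tendsto t atTop (𝓝 0) := tendsto_one_div_add_atTop_nhds_zero_nat
      have hline : Tendsto (fun i => Φ p + t i • w) atTop (𝓝 (Φ p)) := by
        simpa using (htlim.smul_const w).const_add (Φ p)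
      -- Shifting by `N` keeps every term in the chart, since the cone asks for points of `X` at all
      -- indices.
      obtain ⟨N, hN⟩ := eventually_atTop.1 (hline (Φ.open_target.mem_nhds hpt))
      have hshift : Tendsto (fun i : ℕ => i + N) atTop atTop := tendsto_add_atTop_nat N
      refine ⟨fun i => Φ.symm (Φ p + t (i + N) • w), fun _ => p, fun i => t (i + N),
        fun i => hWX _ (W.add_mem hpW (W.smul_mem _ hw)) (hN _ (by lia)), fun _ => hp,
        fun i => ht0 _, ?_, tendsto_const_nhds, ?_⟩
      · have := (Φ.continuousAt_symm hpt).tendsto.comp (hline.comp hshift)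
        rwa [Φ.left_inv hps] at this
      · have hlim := hD'.hasFDerivAt.hasFDerivWithinAt.lim (s := Set.univ)
          (c := fun i => 1 / t (i + N)) (d := fun i => t (i + N) • w) (v := w)
          (by simpa using (htlim.comp hshift).smul_const w) (by simp)
          (tendsto_const_nhds.congr fun i => by
            rw [smul_smul, one_div_mul_cancel (ht0 _).ne', one_smul])
        rw [Φ.left_inv hps] at hlim
        exact hlim
  · rw [← hW]
    exact LinearEquiv.finrank_map_eq D.symm.toLinearEquiv W
  · intro F _ _ _ T hT hF
    let A : W →L[ℝ] F := (T.comp (D.symm : _ →L[ℝ] EuclideanSpace ℝ (Fin n))).comp W.subtypeL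
    have hAinj : Function.Injective (A : W →ₗ[ℝ] F) := by
      rw [← LinearMap.ker_eq_bot, LinearMap.ker_eq_bot']
      intro w hw
      have := hT (D.symm w) ⟨w, w.2, rfl⟩ hw
      simpa using this
    let e : W ≃L[ℝ] F :=
      (LinearMap.linearEquivOfInjective _ hAinj (hW.trans hF.symm)).toContinuousLinearEquiv
    -- `T` restricted to `X`, read in the chart; its derivative is invertible, so it is a local
    -- homeomorphism.
    let ψ : W → F := fun w => T (Φ.symm w)
    have hψ : HasStrictFDerivAt ψ (e : W →L[ℝ] F) ⟨Φ p, hpW⟩ := by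
      have := (T.hasStrictFDerivAt.comp _ (hD'.comp (⟨Φ p, hpW⟩ : W) W.subtypeL.hasStrictFDerivAt))
      exact this
    let Ψ := hψ.toOpenPartialHomeomorph ψ
    obtain ⟨N, hN, hNΨ⟩ := isOpen_induced_iff.1 Ψ.open_source
    refine ⟨Φ.source ∩ Φ ⁻¹' N, Φ.isOpen_inter_preimage hN, ⟨hps, ?_⟩, ?_⟩
    · have : (⟨Φ p, hpW⟩ : W) ∈ Subtype.val ⁻¹' N := by
        rw [hNΨ]; exact hψ.mem_toOpenPartialHomeomorph_source
      exact this
    · intro O hO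
      obtain ⟨O', hO', rfl⟩ := isOpen_induced_iff.1 hO
      have hS : IsOpen (Subtype.val ⁻¹' (Φ.target ∩ Φ.symm ⁻¹' O') ∩ Ψ.source : Set W) :=
        ((Φ.symm.isOpen_inter_preimage hO').preimage continuous_subtype_val).inter Ψ.open_source
      convert Ψ.isOpen_image_of_subset_source hS Set.inter_subset_right using 1
      ext v
      constructor
      · rintro ⟨⟨x, hxX, hxs, hxN⟩, hxO, rfl⟩
        refine ⟨⟨Φ x, hXW x hxX hxs⟩, ⟨⟨Φ.map_source hxs, ?_⟩, hNΨ ▸ hxN⟩, ?_⟩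
        · change Φ.symm (Φ x) ∈ O'
          rw [Φ.left_inv hxs]
          exact hxO
        · change T (Φ.symm (Φ x)) = T x
          rw [Φ.left_inv hxs]
      · rintro ⟨w, ⟨⟨hwt, hwO⟩, hwΨ⟩, rfl⟩
        refine ⟨⟨Φ.symm w, hWX _ w.2 hwt, Φ.map_target hwt, ?_⟩, hwO, rfl⟩
        change Φ (Φ.symm w) ∈ N
        rw [Φ.right_inv hwt]
        rw [← hNΨ] at hwΨ
        exact hwΨ

/-! ### Manifold dimension and definable dimension -/

/-- A `k`-dimensional subspace of `ℝⁿ` is determined by some `k` coordinates. -/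
theorem Submodule.exists_coordinates_injective (P : Submodule ℝ (EuclideanSpace ℝ (Fin n))) {k : ℕ}
    (hk : Module.finrank ℝ P = k) :
    ∃ e : Fin k ↪ Fin n, ∀ v ∈ P, (∀ i, v (e i) = 0) → v = 0 := by
  let ℓ : Fin n → Module.Dual ℝ P := fun i =>
    (EuclideanSpace.proj i : EuclideanSpace ℝ (Fin n) →L[ℝ] ℝ).toLinearMap ∘ₗ P.subtype
  -- A maximal independent subfamily of the coordinate functionals on `P` has the same span, hence
  -- the same common kernel, namely zero.
  obtain ⟨κ, a, ha, hspan, hli⟩ := exists_linearIndependent' ℝ ℓ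
  have : Finite κ := Finite.of_injective a ha
  have := Fintype.ofFinite κ
  have hzero : ∀ v : P, (∀ j, ℓ (a j) v = 0) → v = 0 := by
    intro v hv
    have hle : Submodule.span ℝ (Set.range (ℓ ∘ a)) ≤ LinearMap.ker (Module.Dual.eval ℝ P v) := by
      rw [Submodule.span_le]
      rintro _ ⟨j, rfl⟩
      exact hv j
    rw [hspan] at hle
    ext i
    exact hle (Submodule.subset_span ⟨i, rfl⟩)
  have hcard : Fintype.card κ = k := by
    refine le_antisymm ?_ ?_
    · have := hli.fintype_card_le_finrank
      rwa [Subspace.dual_finrank_eq, hk] at this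
    · have hinj : Function.Injective (LinearMap.pi (ℓ ∘ a)) := by
        rw [← LinearMap.ker_eq_bot, LinearMap.ker_eq_bot']
        intro v hv
        exact hzero v fun j => congrFun hv j
      have := LinearMap.finrank_le_finrank_of_injective hinj
      rwa [Module.finrank_fintype_fun_eq_card, hk] at this
  let σ : Fin k ≃ κ := (Fintype.equivFinOfCardEq hcard).symm
  refine ⟨⟨a ∘ σ, ha.comp σ.injective⟩, fun v hv h => ?_⟩
  refine congrArg Subtype.val (hzero ⟨v, hv⟩ fun j => ?_)
  obtain ⟨i, rfl⟩ := σ.surjective j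
  exact h i

/-- The Hausdorff dimension of a `k`-dimensional `C¹` submanifold is at most `k`. -/
theorem dimH_le_of_isC1SubmanifoldAt {X : Set (EuclideanSpace ℝ (Fin n))} {k : ℕ}
    (hX : ∀ p ∈ X, IsC1SubmanifoldAt k X p) : dimH X ≤ k := by
  by_contra! hlt
  obtain ⟨p, hp, hdim⟩ := exists_mem_nhdsWithin_lt_dimH_of_lt_dimH hlt
  obtain ⟨W, Φ, hW, hps, hΦ, hΦ', himg⟩ := hX p hp
  -- A `C¹` map on a convex set does not raise Hausdorff dimension, hence the ball.
  obtain ⟨r, hr, hball⟩ := Metric.isOpen_iff.1 Φ.open_target _ (Φ.map_source hps)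
  have hpb : Φ p ∈ Metric.ball (Φ p) r := Metric.mem_ball_self hr
  have hnhds : Φ.symm '' ((W : Set (EuclideanSpace ℝ (Fin n))) ∩ Metric.ball (Φ p) r) ∈ 𝓝[X] p := by
    refine mem_nhdsWithin.2 ⟨Φ.source ∩ Φ ⁻¹' Metric.ball (Φ p) r,
      Φ.isOpen_inter_preimage Metric.isOpen_ball, ⟨hps, hpb⟩, ?_⟩
    rintro x ⟨⟨hxs, hxb⟩, hxX⟩
    exact ⟨Φ x, ⟨(himg.subset (Set.mem_image_of_mem Φ ⟨hxX, hxs⟩)).1, hxb⟩, Φ.left_inv hxs⟩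
  refine absurd (hdim _ hnhds) (not_lt.2 ?_)
  calc _ ≤ dimH ((W : Set (EuclideanSpace ℝ (Fin n))) ∩ Metric.ball (Φ p) r) :=
        (hΦ'.mono hball).dimH_image_le (convex_ball _ _) Set.inter_subset_right
    _ ≤ dimH (W : Set (EuclideanSpace ℝ (Fin n))) := dimH_mono Set.inter_subset_left
    _ = dimH (Set.univ : Set W) := by
      rw [← (W.subtypeₗᵢ.isometry).dimH_image, Set.image_univ]
      simp
    _ = k := by rw [Real.dimH_univ_eq_finrank, hW]

/-- The definable dimension of a `C¹` submanifold is its dimension as a manifold. -/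
theorem HasDefinableDim.eq_of_isC1SubmanifoldAt {X : Set (EuclideanSpace ℝ (Fin n))} {d k : ℕ}
    (hdim : HasDefinableDim X d) (hX : ∀ p ∈ X, IsC1SubmanifoldAt k X p) : k = d := by
  obtain ⟨⟨e, he⟩, hmax⟩ := hdim
  let coord {m : ℕ} (f : Fin m ↪ Fin n) : EuclideanSpace ℝ (Fin n) →L[ℝ] (Fin m → ℝ) :=
    ContinuousLinearMap.pi fun i => EuclideanSpace.proj (f i)
  refine le_antisymm ?_ ?_
  -- `k ≤ d`: a coordinate projection injective on the tangent space is open on `X` near `p`.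
  · obtain ⟨p, hp⟩ : X.Nonempty := (he.mono interior_subset).of_image
    obtain ⟨P, -, hPk, hopen⟩ := (hX p hp).exists_tangentSpace hp
    obtain ⟨f, hf⟩ := P.exists_coordinates_injective hPk
    obtain ⟨U, -, hpU, hmap⟩ := hopen (Fin k → ℝ) (coord f)
      (fun v hv hv0 => hf v hv fun i => congrFun hv0 i) (by simp)
    refine hmax ⟨f, coord f p, mem_interior.2 ⟨_, ?_, hmap _ isOpen_univ, ⟨p, hp, hpU⟩, trivial, rfl⟩⟩
    rintro _ ⟨x, -, rfl⟩
    exact ⟨x, x.2.1, rfl⟩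
  -- `d ≤ k`: a Lipschitz image of `X` has interior in `ℝᵈ`, hence Hausdorff dimension `d`.
  · have h1 := Real.dimH_of_nonempty_interior he
    have h2 := (coord e).lipschitz.dimH_image_le X
    have h3 : (d : ENNReal) ≤ k := by
      calc (d : ENNReal) = dimH (coord e '' X) := by
            rw [Module.finrank_fin_fun] at h1; exact h1.symm
        _ ≤ k := h2.trans (dimH_le_of_isC1SubmanifoldAt hX)
    exact_mod_cast h3

theorem theorem3p6 (L : FirstOrder.Language.{u, v}) [L.Structure ℝ] (hL : IsOMinimal L)
    (n d : ℕ) (X : Set (EuclideanSpace ℝ (Fin n)))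
    (hdef : IsDefinableIn L X) (hlc : IsLocallyClosed X) (hdim : HasDefinableDim X d) :
    IsC1Smooth X ↔
      ∀ p ∈ X, ∃ P : Submodule ℝ (EuclideanSpace ℝ (Fin n)),
        tangentCone5 X p = (P : Set (EuclideanSpace ℝ (Fin n))) ∧
        Module.finrank ℝ P = d ∧ IsOpenProjNear X P p := by
  constructor
  · rintro ⟨k, hk⟩ p hp
    obtain rfl := hdim.eq_of_isC1SubmanifoldAt hk
    obtain ⟨P, hP, hPk, hopen⟩ := (hk p hp).exists_tangentSpace hp
    refine ⟨P, hP, hPk, hopen P P.orthogonalProjectionOnto (fun v hv hv0 => ?_) hPk⟩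
    exact (congrArg Subtype.val
      (P.orthogonalProjectionOnto_mem_subspace_eq_self ⟨v, hv⟩)).symm.trans (by simp [hv0])
  · intro h
    refine ⟨d, fun p hp => ?_⟩
    obtain ⟨P, hP, hPd, hopen⟩ := h p hp
    exact isC1SubmanifoldAt_of_tangentCone5
      (fun q hq => (h q hq).imp fun Q hQ => ⟨hQ.1, hQ.2.1⟩) hp hP hPd hopen
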